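/- Assume Martin's axiom: for every nonempty partially ordered set $P$ in which every set of pairwise incompatible elements is countable, and every family of fewer than $2^{\aleph_0}$ dense subsets of $P$, there is a filter in $P$ that meets all of them. Let $G$ be a locally compact (Hausdorff) group with a left Haar measure $\mu$, and let $\mu^*$ be the corresponding outer measure, $\mu^*(X)=\inf\{\mu(U): U\supset X \text{ open}\}$. Let $S\subset G$ be a nonempty locally null set, that is, $\mu^*(S\cap K)=0$ for every compact $K\subset G$. Then there is a set $A\subset G$ such that the product $AS=\{as: a\in A,\ s\in S\}$ is not Haar measurable, that is, not measurable with respect to $\mu^*$ in the sense of Carathéodory. -/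

import Mathlib

open scoped Pointwise

/-- Two conditions of a partial order are compatible if they have a common lower bound
(a common extension, smaller elements being the stronger conditions). -/
def Compatible {P : Type*} [PartialOrder P] (p q : P) : Prop :=
  ∃ r, r ≤ p ∧ r ≤ q

/-- The countable chain condition: every set of pairwise incompatible elements is countable. -/
def CountableChainCondition (P : Type*) [PartialOrder P] : Prop :=
  ∀ C : Set P, C.Pairwise (fun p q => ¬ Compatible p q) → C.Countable

/-- A subset of a partial order is dense if every element has an extension in it. -/
def IsDenseIn {P : Type*} [PartialOrder P] (D : Set P) : Prop :=
  ∀ p, ∃ d ∈ D, d ≤ p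

/-- Martin's axiom: for every nonempty partial order with the countable chain condition and
every family of fewer than continuum many dense subsets, some filter meets all of them. -/
def MartinsAxiom : Prop :=
  ∀ (P : Type) [PartialOrder P] [Nonempty P], CountableChainCondition P →
    ∀ 𝒟 : Set (Set P), Cardinal.mk 𝒟 < Cardinal.continuum → (∀ D ∈ 𝒟, IsDenseIn D) →
      ∃ F : Order.PFilter P, ∀ D ∈ 𝒟, ∃ p ∈ D, p ∈ F

/-- A set is locally null if its intersection with every compact set has (outer) measure zero. -/
def IsLocallyNull {G : Type*} [TopologicalSpace G] [MeasurableSpace G]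
    (μ : MeasureTheory.Measure G) (S : Set G) : Prop :=
  ∀ K : Set G, IsCompact K → μ (S ∩ K) = 0

/-- Measurability with respect to a Haar measure `μ`, in the sense of Carathéodory for the
outer measure `μ^*` of `μ`. (When `μ` is not `σ`-finite this class is larger than the `μ`-completion
of the Borel `σ`-algebra; it contains every locally null set.) -/
def IsHaarMeasurable {G : Type*} [MeasurableSpace G]
    (μ : MeasureTheory.Measure G) (S : Set G) : Prop :=
  μ.toOuterMeasure.IsCaratheodory S

open MeasureTheory Set TopologicalSpace Filter Topology Uniformity

-- Martin's axiom, applied to the compact sets of positive measure, shows that fewer than continuum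
-- many null sets cannot cover a compact set of positive measure. A second countable group has at
-- most continuum many compact sets, so a Bernstein-type recursion over those of positive measure
-- puts a point of `A * S` and a point of its complement into each. Both sets then have full outer
-- measure in a compact neighbourhood of `1`, which rules out Carathéodory measurability.
--
-- The general case reduces to this one. After a translation `1 ∈ S`, and `S` is null in an open
-- σ-compact subgroup. There, completion regularity and the Kakutani–Kodaira theorem give a compact
-- normal subgroup `N` such that the image of `S` in the second countable quotient by `N` is still
-- null. The set `A` found in the quotient is pulled back.

universe u

/-! ### Martin's axiom and coverings by null sets -/

/-- Martin's axiom for posets in an arbitrary universe that have a copy in `Type`. -/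
theorem MartinsAxiom.exists_directedOn_of_small (hMA : MartinsAxiom) {P : Type u} [PartialOrder P]
    [Nonempty P] [Small.{0} P] (hP : CountableChainCondition P) {ι : Type u}
    (hι : Cardinal.mk ι < Cardinal.continuum) (D : ι → Set P) (hD : ∀ i, IsDenseIn (D i)) :
    ∃ F : Set P, F.Nonempty ∧ DirectedOn (· ≥ ·) F ∧ ∀ i, (D i ∩ F).Nonempty := by
  let e : Shrink.{0} P ≃ P := (equivShrink P).symm
  let : PartialOrder (Shrink.{0} P) := PartialOrder.lift e e.injective
  have : Nonempty (Shrink.{0} P) := e.nonempty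
  have hle : ∀ p q : Shrink.{0} P, p ≤ q ↔ e p ≤ e q := fun _ _ => Iff.rfl
  have hccc : CountableChainCondition (Shrink.{0} P) := by
    intro C hC
    have h := hP (e '' C) (by
      rintro _ ⟨p, hp, rfl⟩ _ ⟨q, hq, rfl⟩ hpq ⟨r, hrp, hrq⟩
      refine hC hp hq (fun h => hpq (h ▸ rfl)) ⟨e.symm r, ?_, ?_⟩
      · rw [hle]; simpa using hrp
      · rw [hle]; simpa using hrq)
    exact countable_of_injective_of_countable_image e.injective.injOn h
  obtain ⟨F, hF⟩ := hMA (Shrink.{0} P) hccc (range fun i => e ⁻¹' D i) (by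
      have h := Cardinal.mk_range_le_lift (f := fun i => e ⁻¹' D i)
      rw [← Cardinal.lift_lt.{0, u}, Cardinal.lift_continuum]
      refine h.trans_lt ?_
      simpa using hι) (by
      rintro _ ⟨i, rfl⟩ p
      obtain ⟨d, hd, hdp⟩ := hD i (e p)
      exact ⟨e.symm d, by simpa using hd, by rw [hle]; simpa using hdp⟩)
  refine ⟨e '' F, ?_, ?_, fun i => ?_⟩
  · exact F.nonempty.image e
  · rintro _ ⟨p, hp, rfl⟩ _ ⟨q, hq, rfl⟩
    obtain ⟨r, hr, hrp, hrq⟩ := F.directed p hp q hq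
    exact ⟨e r, ⟨r, hr, rfl⟩, hrp, hrq⟩
  · obtain ⟨p, hp, hpF⟩ := hF _ ⟨i, rfl⟩
    exact ⟨e p, hp, p, hpF, rfl⟩

/-- A closed set in a second countable space is determined by the basic open sets it misses. -/
theorem injective_disjoint_countableBasis (X : Type u) [TopologicalSpace X] [T2Space X]
    [SecondCountableTopology X] :
    Function.Injective fun C : Compacts X => {b : countableBasis X | Disjoint (b : Set X) C} := by
  have key : ∀ C D : Compacts X, {b : countableBasis X | Disjoint (b : Set X) C} =
      {b : countableBasis X | Disjoint (b : Set X) D} → (D : Set X) ⊆ C := by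
    intro C D h x hxD
    by_contra hxC
    obtain ⟨b, hb, hxb, hbC⟩ := (isBasis_countableBasis X).exists_subset_of_mem_open
      (show x ∈ (C : Set X)ᶜ from hxC) C.isCompact.isClosed.isOpen_compl
    have h1 : (⟨b, hb⟩ : countableBasis X) ∈ {b : countableBasis X | Disjoint (b : Set X) C} :=
      disjoint_left.2 fun y hy => hbC hy
    rw [h] at h1
    exact disjoint_left.1 h1 hxb hxD
  intro C D h
  exact SetLike.coe_injective ((key D C h.symm).antisymm (key C D h))

/-- Martin's axiom is stated for posets in `Type`; smallness makes it applicable to posets of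
compact sets in any universe. -/
theorem small_compacts (X : Type u) [TopologicalSpace X] [T2Space X]
    [SecondCountableTopology X] : Small.{0} (Compacts X) :=
  small_of_injective (injective_disjoint_countableBasis X)

theorem mk_compacts_le_continuum (X : Type u) [TopologicalSpace X] [T2Space X]
    [SecondCountableTopology X] : Cardinal.mk (Compacts X) ≤ Cardinal.continuum := by
  refine (Cardinal.mk_le_of_injective (injective_disjoint_countableBasis X)).trans ?_
  rw [Cardinal.mk_set, ← Cardinal.two_power_aleph0]
  exact Cardinal.power_le_power_left two_ne_zero Cardinal.mk_le_aleph0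

/-- Under Martin's axiom a compact set of positive measure is not covered by fewer than
continuum many null sets. -/
theorem MartinsAxiom.exists_mem_forall_notMem (hMA : MartinsAxiom) {X : Type u}
    [TopologicalSpace X] [T2Space X] [SecondCountableTopology X] [MeasurableSpace X] [BorelSpace X]
    (μ : Measure X) [IsFiniteMeasureOnCompacts μ] [SFinite μ] [μ.InnerRegularCompactLTTop]
    {K : Set X} (hK : IsCompact K) (hμK : μ K ≠ 0) {ι : Type u}
    (hι : Cardinal.mk ι < Cardinal.continuum) (N : ι → Set X) (hN : ∀ i, μ (N i) = 0) :
    ∃ x ∈ K, ∀ i, x ∉ N i := by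
  have := small_compacts X
  let P := {C : Compacts X // (C : Set X) ⊆ K ∧ μ C ≠ 0}
  have : Nonempty P := ⟨⟨⟨K, hK⟩, Subset.rfl, hμK⟩⟩
  -- Incompatible conditions meet in a null set, and an s-finite measure admits only countably many
  -- almost disjoint sets of positive measure.
  have hccc : CountableChainCondition P := by
    intro C hC
    have h := Measure.countable_meas_pos_of_disjoint_iUnion₀ (μ := μ)
      (As := fun p : C => ((p : P).1 : Set X))
      (fun p => (p : P).1.isCompact.measurableSet.nullMeasurableSet) (by
        intro p q hpq
        by_contra hne
        exact hC p.2 q.2 (fun h => hpq (Subtype.ext h))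
          ⟨⟨⟨_, (p : P).1.isCompact.inter (q : P).1.isCompact⟩,
            inter_subset_left.trans (p : P).2.1, hne⟩, inter_subset_left, inter_subset_right⟩)
    have huniv : {p : C | 0 < μ ((p : P).1 : Set X)} = univ :=
      eq_univ_of_forall fun p => pos_iff_ne_zero.2 (p : P).2.2
    rw [huniv] at h
    exact countable_coe_iff.1 (countable_univ_iff.1 h)
  obtain ⟨F, hFne, hFdir, hF⟩ := hMA.exists_directedOn_of_small hccc hι
    (fun i => {p : P | Disjoint (p.1 : Set X) (N i)}) (by
      intro i p
      obtain ⟨M, hNM, hM, hM0⟩ := exists_measurable_superset_of_null (hN i)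
      have hpos : 0 < μ ((p.1 : Set X) \ M) := by
        rw [measure_sdiff_null hM0]; exact pos_iff_ne_zero.2 p.2.2
      obtain ⟨C, hCsub, hC, hCpos⟩ :=
        (p.1.isCompact.measurableSet.diff hM).exists_lt_isCompact_of_ne_top
          (ne_top_of_le_ne_top p.1.isCompact.measure_lt_top.ne (measure_mono sdiff_subset)) hpos
      refine ⟨⟨⟨C, hC⟩, (hCsub.trans sdiff_subset).trans p.2.1, hCpos.ne'⟩, ?_,
        hCsub.trans sdiff_subset⟩
      exact disjoint_left.2 fun x hx hxN => (hCsub hx).2 (hNM hxN))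
  have := hFne.coe_sort
  -- By compactness the conditions in the filter have a common point, which avoids each `N i`
  -- because some condition does.
  obtain ⟨x, hx⟩ := IsCompact.nonempty_iInter_of_directed_nonempty_isCompact_isClosed
    (fun p : F => ((p : P).1 : Set X)) (by
      intro p q
      obtain ⟨r, hr, hrp, hrq⟩ := hFdir p p.2 q q.2
      exact ⟨⟨r, hr⟩, hrp, hrq⟩)
    (fun p => nonempty_of_measure_ne_zero (p : P).2.2)
    (fun p => (p : P).1.isCompact) (fun p => (p : P).1.isCompact.isClosed)
  rw [mem_iInter] at hx
  obtain ⟨p, hp⟩ := hFne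
  refine ⟨x, p.2.1 (hx ⟨p, hp⟩), fun i hxi => ?_⟩
  obtain ⟨q, hq, hqF⟩ := hF i
  exact disjoint_left.1 hq (hx ⟨q, hqF⟩) hxi

/-! ### Bernstein construction in second countable groups -/

/-- Under Martin's axiom, a nonempty null set `T` in a second countable locally compact group has a
product `A * T` that is a Bernstein set for the compact sets of positive measure. -/
theorem MartinsAxiom.exists_mul_bernstein (hMA : MartinsAxiom) {Q : Type u} [Group Q]
    [TopologicalSpace Q] [IsTopologicalGroup Q] [LocallyCompactSpace Q] [T2Space Q]
    [SecondCountableTopology Q] [MeasurableSpace Q] [BorelSpace Q] (ν : Measure Q)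
    [ν.IsHaarMeasure] {T : Set Q} (hT : T.Nonempty) (hT0 : ν T = 0) :
    ∃ A : Set Q, ∀ K, IsCompact K → ν K ≠ 0 →
      (K ∩ (A * T)).Nonempty ∧ (K \ (A * T)).Nonempty := by
  obtain ⟨t, ht⟩ := hT
  obtain ⟨ι, c, hι, hc, hsurj⟩ : ∃ (ι : Type u) (c : ι → Compacts Q),
      Cardinal.mk ι ≤ Cardinal.continuum ∧ (∀ i, ν (c i) ≠ 0) ∧
      ∀ K, IsCompact K → ν K ≠ 0 → ∃ i, (c i : Set Q) = K :=
    ⟨{C : Compacts Q // ν C ≠ 0}, Subtype.val,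
      (Cardinal.mk_le_of_injective Subtype.val_injective).trans (mk_compacts_le_continuum Q),
      fun i => i.2, fun K hK hK0 => ⟨⟨⟨K, hK⟩, hK0⟩, rfl⟩⟩
  -- A well-order of least possible type, so that proper initial segments have fewer than continuum
  -- many elements.
  obtain ⟨_, _, hord⟩ := Cardinal.exists_ord_eq_type_lt ι
  have hIio : ∀ i : ι, Cardinal.mk (Iio i) < Cardinal.continuum := fun i =>
    (Cardinal.mk_Iio_lt i hord).trans_le hι
  have hnull_left : ∀ a : Q, ν {y | a⁻¹ * y ∈ T} = 0 := fun a =>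
    (measure_preimage_mul ν a⁻¹ T).trans hT0
  -- Here `z = a * t`. The excluded set is `b * T⁻¹ * t`, null because inversion and translations on
  -- both sides preserve null sets.
  have hnull_inv : ∀ b : Q, ν {z | (z * t⁻¹)⁻¹ * b ∈ T} = 0 := by
    intro b
    have h1 : ν ((fun x => x * b) ⁻¹' T) = 0 := (measure_mul_right_null ν b).2 hT0
    have h2 : ν ((fun x => x * b) ⁻¹' T)⁻¹ = 0 := (measure_inv_null ν).2 h1
    exact (measure_mul_right_null ν t⁻¹).2 h2
  -- The pair is a new element `a` of `A` and a point `y` to be kept out of `A * T`. No `y`, old or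
  -- new, may lie in `a * T` for any `a`, old or new.
  have step : ∀ (i : ι) (f : Iio i → Q × Q), ∃ p : Q × Q, p.1 * t ∈ (c i : Set Q) ∧
      p.2 ∈ (c i : Set Q) ∧ p.1⁻¹ * p.2 ∉ T ∧
      ∀ j, p.1⁻¹ * (f j).2 ∉ T ∧ (f j).1⁻¹ * p.2 ∉ T := by
    intro i f
    obtain ⟨z, hz, hzN⟩ := hMA.exists_mem_forall_notMem ν (c i).isCompact (hc i) (hIio i)
      (fun j => {z | (z * t⁻¹)⁻¹ * (f j).2 ∈ T}) (fun j => hnull_inv _)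
    -- The index `none` stands for the element `a` just chosen.
    have hopt : Cardinal.mk (Option (Iio i)) < Cardinal.continuum := by
      rw [Cardinal.mk_option]
      exact Cardinal.add_lt_of_lt Cardinal.aleph0_le_continuum (hIio i)
        (Cardinal.nat_lt_continuum 1 |>.trans_eq' (by simp))
    obtain ⟨y, hy, hyN⟩ := hMA.exists_mem_forall_notMem ν (c i).isCompact (hc i) hopt
      (fun j => {y | (j.elim (z * t⁻¹) fun k => (f k).1)⁻¹ * y ∈ T}) (fun j => hnull_left _)
    exact ⟨(z * t⁻¹, y), by simpa using hz, hy, hyN none, fun j => ⟨hzN j, hyN (some j)⟩⟩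
  choose g hg1 hg2 hg3 hg4 using step
  let F : ι → Q × Q := WellFoundedLT.fix fun i f => g i fun j => f j.1 j.2
  have hF : ∀ i, F i = g i fun j => F j := fun i =>
    WellFoundedLT.fix_eq (fun i f => g i fun j : Iio i => f j.1 j.2) i
  have havoid : ∀ i j, (F i).1⁻¹ * (F j).2 ∉ T := by
    intro i j
    rcases lt_trichotomy i j with h | rfl | h
    · have := (hg4 j (fun k => F k) ⟨i, h⟩).2
      rwa [← hF j] at this
    · have := hg3 i (fun k => F k)
      rwa [← hF i] at this
    · have := (hg4 i (fun k => F k) ⟨j, h⟩).1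
      rwa [← hF i] at this
  refine ⟨range fun i => (F i).1, fun K hK hK0 => ?_⟩
  obtain ⟨i, rfl⟩ := hsurj K hK hK0
  constructor
  · refine ⟨(F i).1 * t, ?_, mul_mem_mul ⟨i, rfl⟩ ht⟩
    rw [hF i]; exact hg1 i _
  · refine ⟨(F i).2, ?_, ?_⟩
    · rw [hF i]; exact hg2 i _
    · rintro ⟨_, ⟨j, rfl⟩, s, hs, h⟩
      refine havoid j i ?_
      rw [← h]
      simpa using hs

/-! ### The Kakutani–Kodaira theorem -/

/-- A σ-compact topological group with a countable basis of neighbourhoods of the identity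
is second countable. -/
theorem secondCountableTopology_of_isCountablyGenerated_nhds_one {Q : Type*} [Group Q]
    [TopologicalSpace Q] [IsTopologicalGroup Q] [SigmaCompactSpace Q]
    [h : (𝓝 (1 : Q)).IsCountablyGenerated] : SecondCountableTopology Q := by
  let := IsTopologicalGroup.rightUniformSpace Q
  have : (𝓤 Q).IsCountablyGenerated := by
    rw [uniformity_eq_comap_nhds_one']
    infer_instance
  have : SeparableSpace Q := by
    have : PseudoMetrizableSpace Q := UniformSpace.pseudoMetrizableSpace
    rw [← isSeparable_univ_iff, ← iUnion_compactCovering Q]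
    exact IsSeparable.iUnion fun n => (isCompact_compactCovering Q n).isSeparable
  exact UniformSpace.secondCountable_of_separable Q

/-- Conjugation by the elements of a compact set is equicontinuous at the identity. -/
theorem IsCompact.eventually_forall_conj_mem {G : Type*} [Group G] [TopologicalSpace G]
    [IsTopologicalGroup G] {K : Set G} (hK : IsCompact K) {U : Set G} (hU : U ∈ 𝓝 (1 : G)) :
    ∀ᶠ v in 𝓝 (1 : G), ∀ g ∈ K, g * v * g⁻¹ ∈ U := by
  refine hK.eventually_forall_of_forall_eventually fun g _ => ?_
  have h : Continuous fun z : G × G => z.2 * z.1 * z.2⁻¹ := by fun_prop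
  exact h.continuousAt.eventually_mem (by simpa using hU)

/-- The Kakutani–Kodaira theorem: in a σ-compact locally compact group, every sequence of
neighbourhoods of the identity contains a compact normal subgroup with second countable quotient. -/
theorem exists_compact_normal_secondCountable_quotient {G : Type*} [Group G] [TopologicalSpace G]
    [IsTopologicalGroup G] [LocallyCompactSpace G] [T2Space G] [SigmaCompactSpace G]
    (W : ℕ → Set G) (hW : ∀ n, W n ∈ 𝓝 (1 : G)) :
    ∃ N : Subgroup G, N.Normal ∧ IsCompact (N : Set G) ∧ (∀ n, (N : Set G) ⊆ W n) ∧
      SecondCountableTopology (G ⧸ N) := by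
  obtain ⟨K, hK, hK1⟩ := exists_compact_mem_nhds (1 : G)
  -- Symmetry and `V * V ⊆ U` make the intersection of the recursively chosen sets a subgroup; the
  -- conjugation condition over an exhaustion by compact sets makes it normal.
  have step : ∀ (n : ℕ) (U : {U : Set G // U ∈ 𝓝 (1 : G)}), ∃ V : {V : Set G // V ∈ 𝓝 (1 : G)},
      IsClosed V.1 ∧ V.1⁻¹ = V.1 ∧ V.1 * V.1 ⊆ U.1 ∧ V.1 ⊆ W n ∧
      ∀ g ∈ compactCovering G n, ∀ v ∈ V.1, g * v * g⁻¹ ∈ U.1 := by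
    rintro n ⟨U, hU⟩
    have hconj := (isCompact_compactCovering G n).eventually_forall_conj_mem hU
    obtain ⟨V, hV, hVc, hVi, hVV⟩ :=
      exists_closed_nhds_one_inv_eq_mul_subset (inter_mem (inter_mem hU (hW n)) hconj)
    have hsub : V ⊆ V * V := fun v hv => ⟨v, hv, 1, mem_of_mem_nhds hV, mul_one v⟩
    exact ⟨⟨V, hV⟩, hVc, hVi, fun x hx => (hVV hx).1.1, fun x hx => (hVV (hsub hx)).1.2,
      fun g hg v hv => (hVV (hsub hv)).2 g hg⟩
  choose f hfc hfi hfm hfW hfconj using step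
  let V : ℕ → {V : Set G // V ∈ 𝓝 (1 : G)} := fun n => Nat.rec ⟨K, hK1⟩ f n
  have hone : ∀ n, (1 : G) ∈ (V n).1 := fun n => mem_of_mem_nhds (V n).2
  have hsucc : ∀ n, (V (n + 1)).1 ⊆ (V n).1 := fun n v hv =>
    hfm n (V n) ⟨v, hv, 1, hone (n + 1), mul_one v⟩
  have hanti : Antitone fun n => (V n).1 := antitone_nat_of_succ_le hsucc
  have hclosed : ∀ n, IsClosed (V n).1 := by
    rintro (_ | n)
    · exact hK.isClosed
    · exact hfc n (V n)
  have hcompact : ∀ n, IsCompact (V n).1 := fun n =>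
    hK.of_isClosed_subset (hclosed n) (hanti (Nat.zero_le n))
  let N : Subgroup G :=
    { carrier := ⋂ n, (V n).1
      one_mem' := mem_iInter.2 hone
      mul_mem' := fun {x y} hx hy => mem_iInter.2 fun n =>
        hfm n (V n) (mul_mem_mul (mem_iInter.1 hx (n + 1)) (mem_iInter.1 hy (n + 1)))
      inv_mem' := fun {x} hx => mem_iInter.2 fun n => hsucc n (by
        have h : x⁻¹ ∈ (V (n + 1)).1⁻¹ := inv_mem_inv.2 (mem_iInter.1 hx (n + 1))
        rwa [show (V (n + 1)).1⁻¹ = (V (n + 1)).1 from hfi n (V n)] at h) }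
  have hN : (N : Set G) = ⋂ n, (V n).1 := rfl
  have hNnormal : N.Normal := by
    refine ⟨fun v hv g => mem_iInter.2 fun n => ?_⟩
    obtain ⟨m, hm⟩ := exists_mem_compactCovering g
    refine hanti (le_max_left n m) (hfconj (max n m) (V (max n m)) g ?_ v ?_)
    · exact compactCovering_subset G (le_max_right n m) hm
    · exact mem_iInter.1 hv (max n m + 1)
  have hNcompact : IsCompact (N : Set G) :=
    hK.of_isClosed_subset (isClosed_iInter hclosed) (iInter_subset _ 0)
  refine ⟨N, hNnormal, hNcompact, fun n => (iInter_subset _ (n + 1)).trans (hfW n (V n)), ?_⟩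
  -- An open set containing `N = ⋂ V n` contains some `V n`, since the `V n` are compact and
  -- decreasing.
  have hbasis : (𝓝 (1 : G ⧸ N)).HasBasis (fun _ : ℕ => True)
      fun n => ((↑) : G → G ⧸ N) '' (V n).1 := by
    refine ⟨fun O => ⟨fun hO => ?_, ?_⟩⟩
    · obtain ⟨O', hO'O, hO', hO'1⟩ := mem_nhds_iff.1 hO
      obtain ⟨n, hn⟩ := exists_subset_nhds_of_isCompact' (U := ((↑) : G → G ⧸ N) ⁻¹' O')
        (directed_of_isDirected_le fun i j hij => hanti hij) hcompact hclosed (by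
          intro x hx
          refine (hO'.preimage QuotientGroup.continuous_mk).mem_nhds ?_
          have hxN : (x : G ⧸ N) = 1 := (QuotientGroup.eq_one_iff x).2 hx
          simpa [hxN] using hO'1)
      exact ⟨n, trivial, (image_subset_iff.2 hn).trans hO'O⟩
    · rintro ⟨n, -, hn⟩
      exact mem_of_superset
        (QuotientGroup.isOpenMap_coe.image_mem_nhds (V n).2) hn
  have : (𝓝 (1 : G ⧸ N)).IsCountablyGenerated := hbasis.isCountablyGenerated
  have : SigmaCompactSpace (G ⧸ N) := by
    rw [← isSigmaCompact_univ_iff, ← (QuotientGroup.mk_surjective (s := N)).range_eq]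
    exact isSigmaCompact_range QuotientGroup.continuous_mk
  exact secondCountableTopology_of_isCountablyGenerated_nhds_one

/-! ### Completion regularity of Haar measure -/

section Null

variable {G : Type*} [Group G] [TopologicalSpace G] [IsTopologicalGroup G] [LocallyCompactSpace G]
  [MeasurableSpace G] [BorelSpace G] (μ : Measure G) [μ.IsHaarMeasure] [μ.InnerRegular]

/-- Right translates of null sets are null, without countability assumptions on the group. -/
theorem measure_preimage_mul_right_null_of_innerRegular {s : Set G} (hs : μ s = 0) (g : G) :
    μ ((· * g) ⁻¹' s) = 0 := by
  obtain ⟨M, hsM, hM, hM0⟩ := exists_measurable_superset_of_null hs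
  refine measure_mono_null (preimage_mono hsM) ?_
  rw [← Measure.map_apply (measurable_mul_const g) hM,
    Measure.map_right_mul_eq_modularCharacterFun_smul]
  simp [hM0]

/-- If `E` is an `N`-invariant subset of full measure in an open set `U`, then it also has full
measure in `U * N`. -/
theorem measure_mul_subgroup_diff_null [T2Space G] {N : Subgroup G} {U E : Set G}
    (hU : IsOpen U) (hE : MeasurableSet E) (hEN : E * (N : Set G) ⊆ E) (hUE : μ (U \ E) = 0) :
    μ ((U * (N : Set G)) \ E) = 0 := by
  by_contra hne
  obtain ⟨K, hKsub, hK, hKpos⟩ :=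
    ((hU.mul_right (t := (N : Set G))).measurableSet.diff hE).exists_lt_isCompact
      (pos_iff_ne_zero.2 hne)
  refine hKpos.ne' ?_
  -- `U * N` may be an uncountable union of translates of `U`, but finitely many cover the compact
  -- set `K`.
  obtain ⟨t, ht⟩ := hK.elim_finite_subcover (fun n : N => (· * (n : G)⁻¹) ⁻¹' U)
    (fun n => hU.preimage (continuous_mul_const _)) (by
      intro x hx
      obtain ⟨⟨u, hu, n, hn, rfl⟩, -⟩ := hKsub hx
      exact mem_iUnion.2 ⟨⟨n, hn⟩, by simpa using hu⟩)
  refine measure_mono_null (t := ⋃ n ∈ t, (· * (n : G)⁻¹) ⁻¹' (U \ E)) ?_ ?_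
  · intro x hx
    obtain ⟨n, hn, hxn⟩ := mem_iUnion₂.1 (ht hx)
    refine mem_iUnion₂.2 ⟨n, hn, hxn, fun h => (hKsub hx).2 (hEN ?_)⟩
    exact ⟨_, h, n, n.2, by simp⟩
  · exact (measure_biUnion_null_iff t.countable_toSet).2 fun n _ =>
      measure_preimage_mul_right_null_of_innerRegular μ hUE _

end Null

/-- Completion regularity of Haar measure: a null set in a σ-compact locally compact group has null
image in some second countable quotient by a compact normal subgroup. -/
theorem exists_compact_normal_measure_image_null {G : Type*} [Group G] [TopologicalSpace G]
    [IsTopologicalGroup G] [LocallyCompactSpace G] [T2Space G] [SigmaCompactSpace G]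
    [MeasurableSpace G] [BorelSpace G] (μ : Measure G) [μ.IsHaarMeasure] [μ.Regular]
    {S : Set G} (hS : μ S = 0) :
    ∃ N : Subgroup G, N.Normal ∧ IsCompact (N : Set G) ∧ SecondCountableTopology (G ⧸ N) ∧
      ∀ ε : ENNReal, ε ≠ 0 → ∃ U, IsOpen U ∧ S ⊆ U ∧ μ (U * (N : Set G)) ≤ ε := by
  have hU : ∀ k : ℕ, ∃ U ⊇ S, IsOpen U ∧ μ U < ((k : ENNReal) + 1)⁻¹ := fun k =>
    S.exists_isOpen_lt_of_lt _ (by simp [hS])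
  choose U hSU hUo hUlt using hU
  have hUtop : ∀ k, μ (U k) ≠ ⊤ := fun k => ((hUlt k).trans_le le_top).ne
  have hC : ∀ k j : ℕ, ∃ C ⊆ U k, IsCompact C ∧ μ (U k) < μ C + ((j : ENNReal) + 1)⁻¹ :=
    fun k j => (hUo k).measurableSet.exists_isCompact_lt_add (hUtop k) (by simp)
  choose C hCU hCc hClt using hC
  have hW : ∀ k j : ℕ, ∃ W ∈ 𝓝 (1 : G), C k j * W ⊆ U k := fun k j =>
    compact_open_separated_mul_right (hCc k j) (hUo k) (hCU k j)
  choose W hW1 hCW using hW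
  -- The doubly indexed `W` are enumerated by pairing, so that `C k j * N ⊆ U k` for all `k` and
  -- `j`.
  obtain ⟨N, hNn, hNc, hNW, hsec⟩ := exists_compact_normal_secondCountable_quotient
    (fun n => W n.unpair.1 n.unpair.2) fun n => hW1 _ _
  refine ⟨N, hNn, hNc, hsec, fun ε hε => ?_⟩
  obtain ⟨k, hk⟩ := ENNReal.exists_inv_nat_lt hε
  refine ⟨U k, hUo k, hSU k, ?_⟩
  -- An `N`-invariant σ-compact subset of full measure in `U k`; hence saturating `U k` by `N` adds
  -- only a null set.
  let E : Set G := ⋃ j, C k j * (N : Set G)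
  have hEm : MeasurableSet E := MeasurableSet.iUnion fun j => ((hCc k j).mul hNc).measurableSet
  have hEU : E ⊆ U k := iUnion_subset fun j => (mul_subset_mul_left (by
    simpa using hNW (Nat.pair k j))).trans (hCW k j)
  have hEN : E * (N : Set G) ⊆ E := by
    rintro _ ⟨x, hx, n, hn, rfl⟩
    obtain ⟨j, c, hc, m, hm, rfl⟩ := mem_iUnion.1 hx
    exact mem_iUnion.2 ⟨j, c, hc, m * n, N.mul_mem hm hn, (mul_assoc _ _ _).symm⟩
  have hCE : ∀ j, C k j ⊆ E := fun j c hc =>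
    mem_iUnion.2 ⟨j, c, hc, 1, N.one_mem, mul_one c⟩
  have hle : μ (U k) ≤ μ E := by
    refine ENNReal.le_of_forall_pos_le_add fun δ hδ _ => ?_
    obtain ⟨j, hj⟩ := ENNReal.exists_inv_nat_lt (ENNReal.coe_pos.2 hδ).ne'
    refine (hClt k j).le.trans (add_le_add (measure_mono (hCE j)) ?_)
    exact (ENNReal.inv_le_inv.2 le_self_add).trans hj.le
  have hdiff : μ (U k \ E) = 0 := by
    rw [measure_sdiff hEU hEm.nullMeasurableSet
      (ne_top_of_le_ne_top (hUtop k) (measure_mono hEU)), tsub_eq_zero_iff_le]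
    exact hle
  calc μ (U k * (N : Set G)) ≤ μ ((U k * (N : Set G)) \ E ∪ E) := measure_mono (by
        rw [sdiff_union_self]; exact subset_union_left)
    _ ≤ 0 + μ (U k) := (measure_union_le _ _).trans (add_le_add
        (measure_mul_subgroup_diff_null μ (hUo k) hEm hEN hdiff).le (measure_mono hEU))
    _ ≤ ε := by
      rw [zero_add]
      exact ((hUlt k).le.trans (ENNReal.inv_le_inv.2 le_self_add)).trans hk.le

/-! ### Nonmeasurability from compact subsets -/

/-- A set such that neither it nor its complement contains a compact subset of positive measure of
some set `C` of finite positive measure is not Carathéodory measurable. -/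
theorem not_isCaratheodory_of_forall_isCompact {X : Type*} [TopologicalSpace X]
    [MeasurableSpace X] (μ : Measure X) [μ.InnerRegularCompactLTTop] {B C : Set X}
    (hC : MeasurableSet C) (hC0 : μ C ≠ 0) (hCtop : μ C ≠ ⊤)
    (hB : ∀ K ⊆ C, IsCompact K → K ⊆ B → μ K = 0)
    (hB' : ∀ K ⊆ C, IsCompact K → K ⊆ Bᶜ → μ K = 0) : ¬ μ.toOuterMeasure.IsCaratheodory B := by
  -- Otherwise a measurable hull of `C ∩ D` would leave a compact set of positive measure in `C \
  -- D`.
  have key : ∀ D : Set X, (∀ K ⊆ C, IsCompact K → K ⊆ Dᶜ → μ K = 0) → μ C ≤ μ (C ∩ D) := by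
    intro D hD
    let M := toMeasurable μ (C ∩ D)
    have hM : MeasurableSet M := measurableSet_toMeasurable _ _
    have h0 : μ (C \ M) = 0 := by
      by_contra hne
      obtain ⟨K, hKsub, hK, hKpos⟩ := (hC.diff hM).exists_lt_isCompact_of_ne_top
        (ne_top_of_le_ne_top hCtop (measure_mono sdiff_subset)) (pos_iff_ne_zero.2 hne)
      refine hKpos.ne' (hD K (hKsub.trans sdiff_subset) hK fun x hx hxD => (hKsub hx).2 ?_)
      exact subset_toMeasurable μ _ ⟨(hKsub hx).1, hxD⟩
    calc μ C ≤ μ (C ∩ M) + μ (C \ M) := measure_le_inter_add_sdiff μ C M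
      _ ≤ μ M := by rw [h0, add_zero]; exact measure_mono inter_subset_right
      _ = μ (C ∩ D) := measure_toMeasurable _
  intro hcar
  have h1 := key B hB'
  have h2 := key Bᶜ (by simpa using hB)
  have h3 : μ C = μ (C ∩ B) + μ (C \ B) := hcar C
  rw [sdiff_eq] at h3
  -- `B` and `Bᶜ` both have full outer measure in `C`, so splitting `C` along `B` would double its
  -- measure.
  have h4 : μ C + μ C ≤ μ C + 0 := by
    rw [add_zero]
    exact (add_le_add h1 h2).trans h3.ge
  exact hC0 (le_zero_iff.1 ((ENNReal.add_le_add_iff_left hCtop).1 h4))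

/-! ### Lifting from the second countable quotient -/

/-- Under Martin's axiom, a nonempty null set `S` in a σ-compact locally compact group has a product
`A * S` such that every compact set contained in it or disjoint from it is null. -/
theorem MartinsAxiom.exists_mul_forall_isCompact_null (hMA : MartinsAxiom) {G : Type*} [Group G]
    [TopologicalSpace G] [IsTopologicalGroup G] [LocallyCompactSpace G] [T2Space G]
    [SigmaCompactSpace G] [MeasurableSpace G] [BorelSpace G] (μ : Measure G) [μ.IsHaarMeasure]
    [μ.Regular] {S : Set G} (hS : S.Nonempty) (hS0 : μ S = 0) :
    ∃ A : Set G, ∀ K, IsCompact K → K ⊆ A * S ∨ K ⊆ (A * S)ᶜ → μ K = 0 := by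
  obtain ⟨N, hNn, hNc, hsec, hN⟩ := exists_compact_normal_measure_image_null μ hS0
  let : MeasurableSpace (G ⧸ N) := borel (G ⧸ N)
  have : BorelSpace (G ⧸ N) := ⟨rfl⟩
  have : IsClosed (N : Set G) := hNc.isClosed
  let π : G →* G ⧸ N := QuotientGroup.mk' N
  have hπ : Continuous π := QuotientGroup.continuous_mk
  have hsurj : Function.Surjective π := QuotientGroup.mk'_surjective N
  -- The kernel `N` is compact, so `π` is proper and the pushforward of `μ` is again a Haar measure.
  have hproper : IsProperMap π := by
    refine isProperMap_iff_isClosedMap_and_compact_fibers.2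
      ⟨hπ, QuotientGroup.isClosedMap_coe hNc, fun q => ?_⟩
    obtain ⟨x, rfl⟩ := hsurj q
    have h : π ⁻¹' {π x} = {x} * (N : Set G) := by
      rw [← QuotientGroup.preimage_image_mk_eq_mul, image_singleton]; rfl
    rw [h]
    exact isCompact_singleton.mul hNc
  have : (μ.map π).IsHaarMeasure := Measure.isHaarMeasure_map μ π hπ hsurj
    (isProperMap_iff_tendsto_cocompact.1 hproper).2
  -- The preimage of `π '' U` is `U * N`, which has arbitrarily small measure.
  have hT0 : μ.map π (π '' S) = 0 := by
    refine le_zero_iff.1 (le_of_forall_pos_le_add fun ε hε => ?_)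
    obtain ⟨U, hU, hSU, hUε⟩ := hN ε hε.ne'
    rw [zero_add]
    refine (measure_mono (image_mono hSU)).trans ?_
    have hπU : IsOpen (π '' U) := QuotientGroup.isOpenMap_coe U hU
    rw [Measure.map_apply hπ.measurable hπU.measurableSet]
    exact (congrArg μ (QuotientGroup.preimage_image_mk_eq_mul N U)).trans_le hUε
  obtain ⟨A, hA⟩ := hMA.exists_mul_bernstein (μ.map π) (hS.image π) hT0
  have hmem : ∀ x, x ∈ (π ⁻¹' A) * S ↔ π x ∈ A * (π '' S) := by
    intro x
    constructor
    · rintro ⟨a, ha, s, hs, rfl⟩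
      exact ⟨π a, ha, π s, ⟨s, hs, rfl⟩, (map_mul π a s).symm⟩
    · rintro ⟨a, ha, _, ⟨s, hs, rfl⟩, h⟩
      refine ⟨x * s⁻¹, ?_, s, hs, by simp⟩
      have : π (x * s⁻¹) = a := by rw [map_mul, ← h, map_inv]; simp
      rwa [mem_preimage, this]
  refine ⟨π ⁻¹' A, fun K hK hKA => ?_⟩
  have hnull : μ.map π (π '' K) = 0 := by
    by_contra hne
    obtain ⟨⟨_, ⟨x, hx, rfl⟩, hxA⟩, ⟨_, ⟨y, hy, rfl⟩, hyA⟩⟩ := hA _ (hK.image hπ) hne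
    rcases hKA with h | h
    · exact hyA ((hmem y).1 (h hy))
    · exact h hx ((hmem x).2 hxA)
  rw [Measure.map_apply hπ.measurable (hK.image hπ).measurableSet] at hnull
  exact measure_mono_null (subset_preimage_image π K) hnull

/-! ### Reduction to an open σ-compact subgroup -/

/-- A locally compact group has an open σ-compact subgroup. -/
theorem exists_isOpen_isSigmaCompact_subgroup (G : Type*) [Group G] [TopologicalSpace G]
    [IsTopologicalGroup G] [LocallyCompactSpace G] :
    ∃ H : Subgroup G, IsOpen (H : Set G) ∧ IsSigmaCompact (H : Set G) := by
  obtain ⟨K, hK, hK1⟩ := exists_compact_mem_nhds (1 : G)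
  let L := K ∪ K⁻¹
  have hLc : ∀ n : ℕ, IsCompact (L ^ n) := by
    intro n
    induction n with
    | zero => simp
    | succ n ih => rw [pow_succ]; exact ih.mul (hK.union hK.inv)
  have hLinv : L⁻¹ = L := by simp [L, union_comm]
  let H : Subgroup G :=
    { carrier := ⋃ n : ℕ, L ^ n
      one_mem' := mem_iUnion.2 ⟨0, by simp⟩
      mul_mem' := by
        intro x y hx hy
        obtain ⟨m, hm⟩ := mem_iUnion.1 hx
        obtain ⟨n, hn⟩ := mem_iUnion.1 hy
        exact mem_iUnion.2 ⟨m + n, by rw [pow_add]; exact mul_mem_mul hm hn⟩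
      inv_mem' := by
        intro x hx
        obtain ⟨n, hn⟩ := mem_iUnion.1 hx
        refine mem_iUnion.2 ⟨n, ?_⟩
        rw [← hLinv, inv_pow]
        exact inv_mem_inv.2 hn }
  refine ⟨H, Subgroup.isOpen_of_mem_nhds H (g := 1) (mem_of_superset hK1 fun x hx => ?_),
    isSigmaCompact_iUnion_of_isCompact _ hLc⟩
  exact mem_iUnion.2 ⟨1, by rw [pow_one]; exact Or.inl hx⟩

/-- The main theorem in the case where the locally null set contains the identity. -/
theorem MartinsAxiom.exists_not_isHaarMeasurable_mul_of_one_mem (hMA : MartinsAxiom)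
    {G : Type*} [Group G] [TopologicalSpace G] [IsTopologicalGroup G] [LocallyCompactSpace G]
    [T2Space G] [MeasurableSpace G] [BorelSpace G] (μ : Measure G) [μ.IsHaarMeasure] [μ.Regular]
    {S : Set G} (hS : 1 ∈ S) (hS0 : IsLocallyNull μ S) :
    ∃ A : Set G, ¬ IsHaarMeasurable μ (A * S) := by
  obtain ⟨H, hHo, hHσ⟩ := exists_isOpen_isSigmaCompact_subgroup G
  have : SigmaCompactSpace H := isSigmaCompact_iff_sigmaCompactSpace.1 hHσ
  have : LocallyCompactSpace H := hHo.locallyCompactSpace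
  have hemb : IsOpenEmbedding H.subtype := hHo.isOpenEmbedding_subtypeVal
  have : (μ.comap H.subtype).IsHaarMeasure :=
    Measure.IsHaarMeasure.comap (mH := inferInstance) μ hemb
  have : (μ.comap H.subtype).Regular := Measure.Regular.comap' μ hemb
  have hSH : μ.comap H.subtype (H.subtype ⁻¹' S) = 0 := by
    rw [hemb.measurableEmbedding.comap_apply, image_preimage_eq_inter_range]
    obtain ⟨K, hK, hKH⟩ := hHσ
    have hrange : range H.subtype = ⋃ n, K n := by
      rw [hKH]; exact Subtype.range_coe
    rw [hrange, inter_iUnion]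
    exact measure_iUnion_null fun n => hS0 _ (hK n)
  obtain ⟨A, hA⟩ := hMA.exists_mul_forall_isCompact_null (μ.comap H.subtype)
    (S := H.subtype ⁻¹' S) ⟨1, by simpa using hS⟩ hSH
  -- For `a ∈ H`, the product `a * s` lies in `H` only if `s` does, so within `H` only `S ∩ H`
  -- matters.
  have hmem : ∀ x : H, (x : G) ∈ (H.subtype '' A) * S ↔ x ∈ A * (H.subtype ⁻¹' S) := by
    intro x
    constructor
    · rintro ⟨_, ⟨a, ha, rfl⟩, s, hs, h⟩
      refine ⟨a, ha, a⁻¹ * x, ?_, by simp⟩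
      have hs' : (H.subtype (a⁻¹ * x)) = s := by
        rw [map_mul, map_inv, inv_mul_eq_iff_eq_mul]; exact h.symm
      rwa [mem_preimage, hs']
    · rintro ⟨a, ha, s, hs, rfl⟩
      exact ⟨a, ⟨a, ha, rfl⟩, s, hs, rfl⟩
  obtain ⟨C, hC, hC1, hCH⟩ := exists_compact_subset hHo H.one_mem
  have hnull : ∀ K ⊆ C, IsCompact K →
      K ⊆ (H.subtype '' A) * S ∨ K ⊆ ((H.subtype '' A) * S)ᶜ → μ K = 0 := by
    intro K hKC hK hKA
    have hKr : K ⊆ range H.subtype := fun x hx => ⟨⟨x, hCH (hKC hx)⟩, rfl⟩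
    have h := hA (H.subtype ⁻¹' K) (hemb.isInducing.isCompact_preimage' hK hKr)
      (hKA.imp (fun h x hx => (hmem x).1 (h hx)) fun h x hx hxA => h hx ((hmem x).2 hxA))
    rwa [hemb.measurableEmbedding.comap_apply, image_preimage_eq_of_subset hKr] at h
  refine ⟨H.subtype '' A, not_isCaratheodory_of_forall_isCompact μ hC.measurableSet ?_
    hC.measure_lt_top.ne (fun K hKC hK h => hnull K hKC hK (Or.inl h))
    fun K hKC hK h => hnull K hKC hK (Or.inr h)⟩
  exact (Measure.measure_pos_of_mem_nhds μ (mem_interior_iff_mem_nhds.1 hC1)).ne'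

theorem theorem2 (hMA : MartinsAxiom)
    {G : Type*} [Group G] [TopologicalSpace G] [IsTopologicalGroup G] [LocallyCompactSpace G]
    [T2Space G] [MeasurableSpace G] [BorelSpace G]
    (μ : MeasureTheory.Measure G) [μ.IsHaarMeasure] [μ.Regular]
    (S : Set G) (hS : S.Nonempty) (hS0 : IsLocallyNull μ S) :
    ∃ A : Set G, ¬ IsHaarMeasurable μ (A * S) := by
  obtain ⟨s, hs⟩ := hS
  -- The translate `s⁻¹ • S` contains `1`, and the factor `s⁻¹` is absorbed into `A` afterwards.
  obtain ⟨A, hA⟩ := hMA.exists_not_isHaarMeasurable_mul_of_one_mem μ (S := s⁻¹ • S)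
    ⟨s, hs, by simp⟩ (by
      intro K hK
      have h : s⁻¹ • S ∩ K = s⁻¹ • (S ∩ s • K) := by
        rw [smul_set_inter, inv_smul_smul]
      rw [h, measure_smul]
      exact hS0 _ (hK.smul s))
  refine ⟨A * {s⁻¹}, ?_⟩
  rwa [mul_assoc, singleton_mul]
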